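/- Let $(X,d)$ be a compact ultrametric space, i.e. a compact metric space with $d(x,z)\le\max(d(x,y),d(y,z))$ for all $x,y,z\in X$, and let $p\in[1,\infty)$. Let $\mathscr P(X)$ be the set of Borel probability measures on $X$ and $$W_p(\mu,\nu)=\Big(\inf_{\Pi}\int_{X\times X} d(a,b)^p\,\Pi(\mathrm da\,\mathrm db)\Big)^{1/p},$$ the infimum being over all measures $\Pi$ on $X\times X$ with marginals $\mu$ and $\nu$. Let $V$ be the set of balls of positive radius of $X$, regarded as subsets of $X$. It is a rooted tree: the root $o$ is $X$ itself, and the parent $v^*$ of a ball $v\neq o$ is the least ball that strictly contains $v$. For $v\in V$ write $X_v\subseteq X$ for the ball $v$ itself and $h(v)=\tfrac12\operatorname{diam}X_v$ for its height; for $v\ne o$ put $\delta h^p(v^*v)=h(v^*)^p-h(v)^p$. Then: 1. For all $\mu,\nu\in\mathscr P(X)$, $$W_p(\mu,\nu)^p=2^{p-1}\sum_{v\in V\setminus\{o\}}\delta h^p(v^*v)\,|\mu(X_v)-\nu(X_v)|,$$ where the series converges. 2. $(\mathscr P(X),W_p^p)$ is affinely isometric to a convex subset of $\ell^1$. More precisely,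 $V\setminus\{o\}$ is countable, and for every injection $e:V\setminus\{o\}\to\mathbb N$ there is a map $\varphi:\mathscr P(X)\to\ell^1(\mathbb N)$ whose coordinates are $$\varphi(\mu)_{e(v)}=2^{p-1}\,\delta h^p(v^*v)\,\mu(X_v)\quad(v\in V\setminus\{o\}),\qquad \varphi(\mu)_n=0\quad(n\notin e(V\setminus\{o\})),$$ and which is injective, has convex image, and satisfies $\varphi(t\mu+(1-t)\nu)=t\varphi(\mu)+(1-t)\varphi(\nu)$ and $\|\varphi(\mu)-\varphi(\nu)\|_1=W_p(\mu,\nu)^p$ for all $\mu,\nu\in\mathscr P(X)$ and $t\in[0,1]$. -/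

import Mathlib

open MeasureTheory

/-! ### Wasserstein distances -/

/-- The set of transport plans (couplings) of `μ` and `ν`: the measures on `X × X` whose
projections to the two factors are `μ` and `ν`. -/
def transportPlans {X : Type*} [MeasurableSpace X] (μ ν : ProbabilityMeasure X) :
    Set (Measure (X × X)) :=
  {P | P.fst = (μ : Measure X) ∧ P.snd = (ν : Measure X)}

/-- The `L^p` Wasserstein distance: the `p`-th root of the infimum of `∫ d(a,b)^p dP(a,b)` over
all transport plans `P` of `μ` and `ν`. -/
noncomputable def wassersteinDist {X : Type*} [MetricSpace X] [MeasurableSpace X] (p : ℝ)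
    (μ ν : ProbabilityMeasure X) : ℝ :=
  (sInf ((fun P : Measure (X × X) => ∫ z, dist z.1 z.2 ^ p ∂P) '' transportPlans μ ν)) ^ (1 / p)

/-! ### Convex combinations of probability measures -/

/-- The probability measure `t μ + (1 - t) ν`, for `t ∈ [0,1]`. -/
noncomputable def mixMeasure {X : Type*} [MeasurableSpace X] (t : ℝ) (ht : t ∈ Set.Icc (0 : ℝ) 1)
    (μ ν : ProbabilityMeasure X) : ProbabilityMeasure X :=
  ⟨ENNReal.ofReal t • (μ : Measure X) + ENNReal.ofReal (1 - t) • (ν : Measure X), ⟨by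
    have h1 : (0 : ℝ) ≤ 1 - t := sub_nonneg.2 ht.2
    simp [← ENNReal.ofReal_add ht.1 h1]⟩⟩

/-! ### The rooted tree of balls of a compact ultrametric space

The vertices are the balls of positive radius, the root is the whole space, the parent of a ball
is the least ball that contains it strictly, and the height of a ball is half its diameter. -/

/-- The vertices of the tree: the balls of positive radius, as subsets of `X` ordered by
inclusion. (In a compact ultrametric space open balls of positive radius are also of this form;
a one-point set is a vertex exactly when the point is isolated.) -/
abbrev BallVertex (X : Type*) [MetricSpace X] : Type _ :=
  {B : Set X // ∃ (x : X) (r : ℝ), 0 < r ∧ B = Metric.closedBall x r}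

/-- The vertices other than the root, that is, the balls other than `X` itself. -/
abbrev NonRootVertex (X : Type*) [MetricSpace X] : Type _ :=
  {v : BallVertex X // (v : Set X) ≠ Set.univ}

/-- Height of a vertex: half the diameter of the ball. -/
noncomputable def BallVertex.height {X : Type*} [MetricSpace X] (v : BallVertex X) : ℝ :=
  Metric.diam (v : Set X) / 2

theorem NonRootVertex.exists_parent {X : Type*} [MetricSpace X] [CompactSpace X]
    [IsUltrametricDist X] (v : NonRootVertex X) :
    ∃ w : BallVertex X, IsLeast {u : BallVertex X | v.1 < u} w := by
  obtain ⟨⟨B, x, r, hr, rfl⟩, hB⟩ := v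
  have hopen : IsOpen (Metric.closedBall x r) :=
    (IsUltrametricDist.isClopen_closedBall x hr.ne').isOpen
  have hne : (Metric.closedBall x r)ᶜ.Nonempty := Set.nonempty_compl.2 hB
  obtain ⟨y, hy, hmin⟩ := hopen.isClosed_compl.isCompact.exists_isMinOn hne
    (f := fun y => dist y x) (by fun_prop)
  have hry : r < dist y x := by simpa using hy
  refine ⟨⟨Metric.closedBall x (dist y x), x, dist y x, hr.trans hry, rfl⟩, ?_, ?_⟩
  · show Metric.closedBall x r < Metric.closedBall x (dist y x)
    refine ⟨Metric.closedBall_subset_closedBall hry.le, fun h => hy (h ?_)⟩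
    simp
  · rintro ⟨u, z, t, ht, rfl⟩ hu
    have hu' : Metric.closedBall x r < Metric.closedBall z t := hu
    have hx : x ∈ Metric.closedBall z t := hu'.1 (Metric.mem_closedBall_self hr.le)
    have heq : Metric.closedBall z t = Metric.closedBall x t :=
      (IsUltrametricDist.closedBall_eq_of_mem hx)
    obtain ⟨a, ha, ha'⟩ := Set.not_subset.1 hu'.2
    rw [heq] at ha
    have h1 : dist y x ≤ dist a x := hmin ha'
    show Metric.closedBall x (dist y x) ⊆ Metric.closedBall z t
    rw [heq]
    exact Metric.closedBall_subset_closedBall (h1.trans ha)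

/-- The parent `v*` of a vertex `v` other than the root: the least ball that strictly
contains `v`. -/
noncomputable def NonRootVertex.parent {X : Type*} [MetricSpace X] [CompactSpace X]
    [IsUltrametricDist X] (v : NonRootVertex X) : BallVertex X :=
  v.exists_parent.choose

theorem NonRootVertex.isLeast_parent {X : Type*} [MetricSpace X] [CompactSpace X]
    [IsUltrametricDist X] (v : NonRootVertex X) :
    IsLeast {u : BallVertex X | v.1 < u} v.parent :=
  v.exists_parent.choose_spec

/-- `δh^p(v* v) = h(v*)^p - h(v)^p`. -/
noncomputable def NonRootVertex.deltaHeight {X : Type*} [MetricSpace X] [CompactSpace X]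
    [IsUltrametricDist X] (p : ℝ) (v : NonRootVertex X) : ℝ :=
  v.parent.height ^ p - v.1.height ^ p

/-! The key identity is a telescoping sum. The balls that contain `x` but not `y` form the branch
below the least ball containing both, whose height is `d(x,y)/2`. Along this branch the increments
of `h ^ p` add up to `(d(x,y)/2) ^ p`. Adding the same sum with `x` and `y` exchanged and
multiplying by `2 ^ (p - 1)` gives `d(x,y) ^ p`. Integrated against a plan, this expresses the cost
as a weighted sum of the masses that enter and leave each ball (`lintegral_dist_rpow`).

For the lower bound, any plan must carry at least the excess `μ(v) - ν(v)` out of `v` and at least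
the deficit into it (`treeDist_le_lintegral`).

For the upper bound, balls are pairwise nested or disjoint. For finitely many of them, a greedy
coupling that matches as much mass as possible inside small sets before large ones meets all these
bounds at once (`exists_transportPlan_of_laminar`). The mass crossing any remaining ball is at most
its `μ + ν` mass, so the error is a tail of a convergent series. Exhausting the vertices gives the
infimum without constructing an optimal plan.

The embedding uses the weighted ball masses as coordinates. The formula is then its isometry
property, the coordinates are affine in the measure, and balls form a π-system generating the Borel
sets, which gives injectivity. -/

/-! ### Partial couplings along a finite laminar family -/

/-- The mass that two finite measures share on a set `B` can be coupled inside `B`, so that at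
most one of the residual measures charges `B`. -/
theorem exists_coupling_within_of_le {X : Type*} [MeasurableSpace X] (μ ν : Measure X)
    [IsFiniteMeasure μ] [IsFiniteMeasure ν] {B : Set X} (hB : MeasurableSet B)
    (hle : μ B ≤ ν B) :
    ∃ (Q : Measure (X × X)) (μ' ν' : Measure X), Q.fst + μ' = μ ∧ Q.snd + ν' = ν ∧
      Q (B ×ˢ B)ᶜ = 0 ∧ μ' B = 0 := by
  by_cases h0 : ν B = 0
  · exact ⟨0, μ, ν, by simp, by simp, by simp, le_antisymm (hle.trans h0.le) zero_le⟩
  have hfin : ν B ≠ ⊤ := measure_ne_top _ _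
  have hc : (ν B)⁻¹ * μ B ≤ 1 := by
    rw [← ENNReal.div_eq_inv_mul]
    exact ENNReal.div_le_of_le_mul (by simpa using hle)
  -- The product is normalised so that it uses all of `μ` on `B` and only the fraction `μ B / ν B`
  -- of `ν` there.
  refine ⟨(ν B)⁻¹ • (μ.restrict B).prod (ν.restrict B), μ.restrict Bᶜ,
    ν.restrict Bᶜ + (1 - (ν B)⁻¹ * μ B) • ν.restrict B, ?_, ?_, ?_, ?_⟩
  · have : ((ν B)⁻¹ • (μ.restrict B).prod (ν.restrict B)).fst = μ.restrict B := by
      rw [Measure.fst, Measure.map_smul, Measure.map_fst_prod, smul_smul,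
        Measure.restrict_apply_univ, ENNReal.inv_mul_cancel h0 hfin, one_smul]
    rw [this, Measure.restrict_add_restrict_compl hB]
  · have : ((ν B)⁻¹ • (μ.restrict B).prod (ν.restrict B)).snd
        = ((ν B)⁻¹ * μ B) • ν.restrict B := by
      rw [Measure.snd, Measure.map_smul, Measure.map_snd_prod, smul_smul,
        Measure.restrict_apply_univ]
    rw [this, add_left_comm, ← add_smul, add_tsub_cancel_of_le hc, one_smul, add_comm,
      Measure.restrict_add_restrict_compl hB]
  · rw [Measure.prod_restrict, Measure.smul_apply,
      Measure.restrict_apply (hB.prod hB).compl]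
    simp
  · rw [Measure.restrict_apply hB]
    simp

theorem exists_coupling_within {X : Type*} [MeasurableSpace X] (μ ν : Measure X)
    [IsFiniteMeasure μ] [IsFiniteMeasure ν] {B : Set X} (hB : MeasurableSet B) :
    ∃ (Q : Measure (X × X)) (μ' ν' : Measure X), Q.fst + μ' = μ ∧ Q.snd + ν' = ν ∧
      Q (B ×ˢ B)ᶜ = 0 ∧ (μ' B = 0 ∨ ν' B = 0) := by
  rcases le_total (μ B) (ν B) with h | h
  · obtain ⟨Q, μ', ν', h1, h2, h3, h4⟩ := exists_coupling_within_of_le μ ν hB h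
    exact ⟨Q, μ', ν', h1, h2, h3, Or.inl h4⟩
  · obtain ⟨Q, μ', ν', h1, h2, h3, h4⟩ := exists_coupling_within_of_le ν μ hB h
    refine ⟨Q.map Prod.swap, ν', μ', by simpa using h2, by simpa using h1, ?_, Or.inr h4⟩
    rw [Measure.map_apply measurable_swap (hB.prod hB).compl]
    simpa [Set.preimage_compl, Set.preimage_swap_prod] using h3

/-- Along a finite laminar family, two finite measures have a partial coupling that carries out
of (into) each set of the family no more than the excess (deficit) of mass. -/
theorem exists_partialCoupling {X : Type*} [MeasurableSpace X] (μ ν : Measure X)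
    [IsFiniteMeasure μ] [IsFiniteMeasure ν] (F : Finset (Set X))
    (hmeas : ∀ C ∈ F, MeasurableSet C)
    (hlam : ∀ C ∈ F, ∀ D ∈ F, C ⊆ D ∨ D ⊆ C ∨ Disjoint C D) :
    ∃ (P : Measure (X × X)) (μ' ν' : Measure X), P.fst + μ' = μ ∧ P.snd + ν' = ν ∧
      (∀ s, (∀ C ∈ F, C ⊆ s ∨ Disjoint C s) → P (s ×ˢ sᶜ) = 0 ∧ P (sᶜ ×ˢ s) = 0) ∧
      ∀ C ∈ F, P (C ×ˢ Cᶜ) + μ' C ≤ μ C - ν C ∧ P (Cᶜ ×ˢ C) + ν' C ≤ ν C - μ C := by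
  classical
  induction F using Finset.strongInduction with
  | H F ih =>
  rcases F.eq_empty_or_nonempty with rfl | hne
  · exact ⟨0, μ, ν, by simp, by simp, by simp, by simp⟩
  -- A maximal set is split off so that it is treated last: the induction couples inside the smaller
  -- sets, and only the residual measures are then coupled inside `B`.
  obtain ⟨B, hBF, hBmax⟩ := F.exists_maximal hne
  have hB := hmeas B hBF
  have hsub : ∀ C ∈ F.erase B, C ⊆ B ∨ Disjoint C B := by
    intro C hC
    have hCF := Finset.mem_of_mem_erase hC
    rcases hlam C hCF B hBF with h | h | h
    · exact Or.inl h
    · exact Or.inl (hBmax hCF h)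
    · exact Or.inr h
  obtain ⟨P, μ', ν', h1, h2, h3, h4⟩ := ih (F.erase B) (Finset.erase_ssubset hBF)
    (fun C hC => hmeas C (Finset.mem_of_mem_erase hC))
    (fun C hC D hD => hlam C (Finset.mem_of_mem_erase hC) D (Finset.mem_of_mem_erase hD))
  have : IsFiniteMeasure μ' := isFiniteMeasure_of_le μ (h1 ▸ Measure.le_add_left le_rfl)
  have : IsFiniteMeasure ν' := isFiniteMeasure_of_le ν (h2 ▸ Measure.le_add_left le_rfl)
  obtain ⟨Q, μ'', ν'', g1, g2, g3, g4⟩ := exists_coupling_within μ' ν' hB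
  have hf : (P + Q).fst + μ'' = μ := by
    rw [Measure.fst_add, add_assoc, g1, h1]
  have hs : (P + Q).snd + ν'' = ν := by
    rw [Measure.snd_add, add_assoc, g2, h2]
  have hsupp : ∀ s, (∀ C ∈ F, C ⊆ s ∨ Disjoint C s) →
      (P + Q) (s ×ˢ sᶜ) = 0 ∧ (P + Q) (sᶜ ×ˢ s) = 0 := by
    intro s hsF
    obtain ⟨a, b⟩ := h3 s fun C hC => hsF C (Finset.mem_of_mem_erase hC)
    have hQ : Q (s ×ˢ sᶜ) = 0 ∧ Q (sᶜ ×ˢ s) = 0 := by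
      constructor
      · refine measure_mono_null ?_ g3
        rintro ⟨x, y⟩ ⟨hx, hy⟩ ⟨hx', hy'⟩
        rcases hsF B hBF with h | h
        · exact hy (h hy')
        · exact Set.disjoint_left.1 h hx' hx
      · refine measure_mono_null ?_ g3
        rintro ⟨x, y⟩ ⟨hx, hy⟩ ⟨hx', hy'⟩
        rcases hsF B hBF with h | h
        · exact hx (h hx')
        · exact Set.disjoint_left.1 h hy' hy
    simp [a, b, hQ]
  refine ⟨P + Q, μ'', ν'', hf, hs, hsupp, ?_⟩
  intro C hC
  have hCm := hmeas C hC
  by_cases hCB : C = B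
  · subst hCB
    -- The other sets lie in `B` or miss it, so the earlier coupling does not cross `B`; neither
    -- does `Q`. Since at most one residual charges `B`, its mass there is exactly the excess or
    -- deficit.
    obtain ⟨a, b⟩ := h3 C hsub
    have a' : (P + Q) (C ×ˢ Cᶜ) = 0 := by
      have : Q (C ×ˢ Cᶜ) = 0 := measure_mono_null (t := (C ×ˢ C)ᶜ) (fun z hz hz' => hz.2 hz'.2) g3
      simp [a, this]
    have b' : (P + Q) (Cᶜ ×ˢ C) = 0 := by
      have : Q (Cᶜ ×ˢ C) = 0 := measure_mono_null (t := (C ×ˢ C)ᶜ) (fun z hz hz' => hz.1 hz'.1) g3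
      simp [b, this]
    have e1 : μ C = (P + Q) (C ×ˢ C) + μ'' C := by
      conv_lhs => rw [← hf]
      rw [Measure.add_apply, Measure.fst_apply hCm,
        ← measure_inter_add_sdiff (Prod.fst ⁻¹' C) (measurable_snd hCm)]
      have : Prod.fst ⁻¹' C \ Prod.snd ⁻¹' C = C ×ˢ Cᶜ := by ext; simp
      rw [this, a', add_zero]; rfl
    have e2 : ν C = (P + Q) (C ×ˢ C) + ν'' C := by
      conv_lhs => rw [← hs]
      rw [Measure.add_apply, Measure.snd_apply hCm,
        ← measure_inter_add_sdiff (Prod.snd ⁻¹' C) (measurable_fst hCm)]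
      have : Prod.snd ⁻¹' C \ Prod.fst ⁻¹' C = Cᶜ ×ˢ C := by ext; simp [and_comm]
      have h' : Prod.snd ⁻¹' C ∩ Prod.fst ⁻¹' C = C ×ˢ C := by ext; simp [and_comm]
      rw [this, b', add_zero, h']
    have hfin : (P + Q) (C ×ˢ C) ≠ ⊤ := ne_top_of_le_ne_top (measure_ne_top μ C) (by simp [e1])
    rw [a', b', zero_add, zero_add, e1, e2]
    rcases g4 with g | g
    · rw [g, add_zero, ENNReal.add_sub_cancel_left hfin]
      simp
    · rw [g, add_zero, ENNReal.add_sub_cancel_left hfin]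
      simp
  · have hC' := Finset.mem_erase.2 ⟨hCB, hC⟩
    obtain ⟨a, b⟩ := h4 C hC'
    -- Whatever `Q` carries out of `C` is taken from the old residual on `C`. Including the residual
    -- in the inductive bound therefore keeps that bound valid.
    have ka : Q (C ×ˢ Cᶜ) + μ'' C ≤ μ' C := by
      conv_rhs => rw [← g1]
      rw [Measure.add_apply, Measure.fst_apply hCm]
      gcongr
      exact fun z hz => hz.1
    have kb : Q (Cᶜ ×ˢ C) + ν'' C ≤ ν' C := by
      conv_rhs => rw [← g2]
      rw [Measure.add_apply, Measure.snd_apply hCm]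
      gcongr
      exact fun z hz => hz.2
    constructor
    · refine le_trans ?_ a
      rw [Measure.add_apply, add_assoc]
      gcongr
    · refine le_trans ?_ b
      rw [Measure.add_apply, add_assoc]
      gcongr

/-- Two probability measures have a coupling that carries out of (into) each set of a given finite
laminar family no more than the excess (deficit) of mass. -/
theorem exists_transportPlan_of_laminar {X : Type*} [MeasurableSpace X]
    (μ ν : ProbabilityMeasure X) (F : Finset (Set X)) (hmeas : ∀ C ∈ F, MeasurableSet C)
    (hlam : ∀ C ∈ F, ∀ D ∈ F, C ⊆ D ∨ D ⊆ C ∨ Disjoint C D) :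
    ∃ P ∈ transportPlans μ ν, ∀ C ∈ F,
      P (C ×ˢ Cᶜ) ≤ (μ : Measure X) C - (ν : Measure X) C ∧
      P (Cᶜ ×ˢ C) ≤ (ν : Measure X) C - (μ : Measure X) C := by
  classical
  obtain ⟨P, μ', ν', h1, h2, -, h4⟩ := exists_partialCoupling (μ : Measure X) (ν : Measure X)
    -- The whole space has neither excess nor deficit, so its bounds force both residuals to vanish
    -- and the coupling is complete.
    (insert Set.univ F) (by simpa using hmeas) (by
      intro C hC D hD
      rcases Finset.mem_insert.1 hC with rfl | hC
      · exact Or.inr (Or.inl (Set.subset_univ _))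
      rcases Finset.mem_insert.1 hD with rfl | hD
      · exact Or.inl (Set.subset_univ _)
      exact hlam C hC D hD)
  have hu := h4 Set.univ (Finset.mem_insert_self _ _)
  have hμ : μ' = 0 := by simpa using hu.1
  have hν : ν' = 0 := by simpa using hu.2
  refine ⟨P, ⟨by simpa [hμ] using h1, by simpa [hν] using h2⟩, fun C hC => ?_⟩
  have := h4 C (Finset.mem_insert_of_mem hC)
  exact ⟨le_self_add.trans this.1, le_self_add.trans this.2⟩
/-! ### The tree of balls -/

namespace BallVertex

variable {X : Type*} [MetricSpace X]

/-- The ball of positive radius `r` about `x` as a vertex. -/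
def ofBall (x : X) (r : ℝ) (hr : 0 < r) : BallVertex X :=
  ⟨Metric.closedBall x r, x, r, hr, rfl⟩

theorem nonempty (v : BallVertex X) : (v : Set X).Nonempty := by
  obtain ⟨B, x, r, hr, rfl⟩ := v
  exact ⟨x, Metric.mem_closedBall_self hr.le⟩

theorem height_nonneg (v : BallVertex X) : 0 ≤ v.height :=
  div_nonneg Metric.diam_nonneg zero_le_two

section Ultrametric

variable [IsUltrametricDist X]

theorem exists_eq_closedBall (v : BallVertex X) {x : X} (hx : x ∈ (v : Set X)) :
    ∃ r : ℝ, 0 < r ∧ (v : Set X) = Metric.closedBall x r := by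
  obtain ⟨B, z, r, hr, rfl⟩ := v
  exact ⟨r, hr, IsUltrametricDist.closedBall_eq_of_mem hx⟩

theorem isClopen (v : BallVertex X) : IsClopen (v : Set X) := by
  obtain ⟨B, x, r, hr, rfl⟩ := v
  exact IsUltrametricDist.isClopen_closedBall x hr.ne'

theorem le_total_of_mem (u v : BallVertex X) {x : X} (hu : x ∈ (u : Set X))
    (hv : x ∈ (v : Set X)) : u ≤ v ∨ v ≤ u := by
  obtain ⟨r, -, hr⟩ := u.exists_eq_closedBall hu
  obtain ⟨s, -, hs⟩ := v.exists_eq_closedBall hv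
  rcases le_total r s with h | h
  · left
    show (u : Set X) ⊆ v
    rw [hr, hs]
    exact Metric.closedBall_subset_closedBall h
  · right
    show (v : Set X) ⊆ u
    rw [hr, hs]
    exact Metric.closedBall_subset_closedBall h

theorem subset_trichotomy (u v : BallVertex X) :
    (u : Set X) ⊆ v ∨ (v : Set X) ⊆ u ∨ Disjoint (u : Set X) v := by
  by_cases h : Disjoint (u : Set X) v
  · exact Or.inr (Or.inr h)
  · obtain ⟨x, hx, hx'⟩ := Set.not_disjoint_iff.1 h
    exact (u.le_total_of_mem v hx hx').imp id Or.inl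

theorem diam_closedBall_le (x : X) {r : ℝ} (hr : 0 ≤ r) :
    Metric.diam (Metric.closedBall x r) ≤ r :=
  Metric.diam_le_of_forall_dist_le hr fun a ha b hb =>
    (dist_triangle_max a x b).trans (max_le ha (by rw [dist_comm]; exact hb))

end Ultrametric

section Compact

variable [CompactSpace X]

theorem dist_le_diam (v : BallVertex X) {x y : X} (hx : x ∈ (v : Set X)) (hy : y ∈ (v : Set X)) :
    dist x y ≤ Metric.diam (v : Set X) :=
  Metric.dist_le_diam_of_mem (Metric.isBounded_of_compactSpace) hx hy

theorem height_mono {u v : BallVertex X} (h : u ≤ v) : u.height ≤ v.height :=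
  div_le_div_of_nonneg_right (Metric.diam_mono h Metric.isBounded_of_compactSpace) zero_le_two

/-- The root. -/
noncomputable def root (X : Type*) [MetricSpace X] [CompactSpace X] [Nonempty X] : BallVertex X :=
  -- The added `1` keeps the radius positive on a one-point space.
  ofBall (Classical.arbitrary X) (Metric.diam (Set.univ : Set X) + 1)
    (by have := Metric.diam_nonneg (s := (Set.univ : Set X)); linarith)

theorem coe_root [Nonempty X] : (root X : Set X) = Set.univ := by
  refine Set.eq_univ_of_forall fun y => ?_
  have := Metric.dist_le_diam_of_mem (s := (Set.univ : Set X)) Metric.isBounded_of_compactSpace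
    (Set.mem_univ y) (Set.mem_univ (Classical.arbitrary X))
  show dist y _ ≤ Metric.diam (Set.univ : Set X) + 1
  linarith

variable [IsUltrametricDist X]

/-- A point of the larger ball outside a closed ball of radius `r` is farther than `r` from its
centre, while in an ultrametric space the smaller ball has diameter at most `r`. -/
theorem height_strictMono : StrictMono (height : BallVertex X → ℝ) := by
  intro u v h
  obtain ⟨x, hx⟩ := u.nonempty
  obtain ⟨y, hy, hyu⟩ := Set.exists_of_ssubset (show (u : Set X) ⊂ v from h)
  obtain ⟨r, hr, hur⟩ := u.exists_eq_closedBall hx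
  have h1 : r < dist y x := by
    rw [hur] at hyu
    simpa using hyu
  have h2 : dist y x ≤ Metric.diam (v : Set X) := v.dist_le_diam hy (h.le hx)
  have h3 : Metric.diam (u : Set X) ≤ r := by
    rw [hur]
    exact diam_closedBall_le x hr.le
  unfold height
  linarith

/-- Balls are clopen, and a second countable compact space has only countably many clopen sets. -/
instance : Countable (BallVertex X) := by
  have : SecondCountableTopology X := UniformSpace.secondCountable_of_separable X
  have : Countable (TopologicalSpace.Clopens X) :=
    TopologicalSpace.Clopens.countable_iff_secondCountable.2 this
  refine Function.Injective.countable
    (f := fun v : BallVertex X => (⟨v, v.isClopen⟩ : TopologicalSpace.Clopens X)) ?_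
  intro u v h
  exact Subtype.ext (congrArg (fun c : TopologicalSpace.Clopens X => (c : Set X)) h)

/-- Every open ball is a vertex. -/
theorem exists_eq_ball (x : X) {s : ℝ} (hs : 0 < s) :
    ∃ v : BallVertex X, (v : Set X) = Metric.ball x s := by
  have hc : IsCompact (Metric.ball x s) := (IsUltrametricDist.isClosed_ball x s).isCompact
  obtain ⟨y, hy, hmax⟩ := hc.exists_isMaxOn ⟨x, Metric.mem_ball_self hs⟩
    (f := fun y => dist y x) (by fun_prop)
  -- The farthest distance attained in the open ball serves as closed radius; `s / 2` keeps it
  -- positive when the ball is `{x}`.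
  refine ⟨ofBall x (max (dist y x) (s / 2)) (lt_max_of_lt_right (half_pos hs)), ?_⟩
  refine Set.Subset.antisymm ?_ fun z hz => ?_
  · exact Metric.closedBall_subset_ball (max_lt hy (half_lt_self hs))
  · have hzy : dist z x ≤ dist y x := hmax hz
    exact hzy.trans (le_max_left _ _)

/-- The inequality is strict because the diameter is attained by compactness, and the ultrametric
inequality keeps every distance inside the open ball below `s`. -/
theorem diam_lt_of_eq_ball {v : BallVertex X} {x : X} {s : ℝ}
    (h : (v : Set X) = Metric.ball x s) : Metric.diam (v : Set X) < s := by
  have hc : IsCompact ((v : Set X) ×ˢ (v : Set X)) :=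
    v.isClopen.isClosed.isCompact.prod v.isClopen.isClosed.isCompact
  obtain ⟨⟨a, b⟩, ⟨ha, hb⟩, hmax⟩ := hc.exists_isMaxOn (v.nonempty.prod v.nonempty)
    (f := fun z => dist z.1 z.2) (by fun_prop)
  have hab : dist a b < s := by
    rw [h] at ha hb
    exact (dist_triangle_max a x b).trans_lt (max_lt ha (by rw [dist_comm]; exact hb))
  exact (Metric.diam_le_of_forall_dist_le dist_nonneg fun y hy z hz =>
    hmax (Set.mk_mem_prod hy hz)).trans_lt hab

end Compact

end BallVertex

/-! ### Telescoping increments of height along a branch -/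

namespace NonRootVertex

variable {X : Type*} [MetricSpace X] [CompactSpace X] [IsUltrametricDist X]

theorem lt_parent (v : NonRootVertex X) : v.1 < v.parent := v.isLeast_parent.1

theorem parent_le (v : NonRootVertex X) {u : BallVertex X} (h : v.1 < u) : v.parent ≤ u :=
  v.isLeast_parent.2 h

theorem deltaHeight_pos {p : ℝ} (hp : 0 < p) (v : NonRootVertex X) : 0 < v.deltaHeight p :=
  sub_pos.2 (Real.rpow_lt_rpow v.1.height_nonneg (BallVertex.height_strictMono v.lt_parent) hp)

/-- The increments of `h ^ p` on the vertices strictly between a vertex `u` and a point `x`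
of `u`. -/
noncomputable def incrementSet (p : ℝ) (x : X) (u : BallVertex X) (v : NonRootVertex X) : Set ℝ :=
  {t | x ∈ (v.1 : Set X) ∧ v.1 < u ∧ t ∈ Set.Ioc (v.1.height ^ p) (v.parent.height ^ p)}

/-- Two balls containing `x` are nested, and the parent of the smaller lies below the larger, so
their height intervals do not overlap. -/
theorem pairwise_disjoint_incrementSet {p : ℝ} (hp : 0 < p) (x : X) (u : BallVertex X) :
    Pairwise (Function.onFun Disjoint (incrementSet p x u)) := by
  intro v w hvw
  refine Set.disjoint_left.2 ?_
  rintro t ⟨hv, -, hv1, hv2⟩ ⟨hw, -, hw1, hw2⟩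
  have key : ∀ a b : NonRootVertex X, a.1 < b.1 → t ≤ a.parent.height ^ p →
      b.1.height ^ p < t → False := by
    intro a b hab ha hb
    have := Real.rpow_le_rpow a.parent.height_nonneg
      (BallVertex.height_mono (a.parent_le hab)) hp.le
    linarith
  have hne : v.1 ≠ w.1 := fun h => hvw (Subtype.ext h)
  rcases v.1.le_total_of_mem w.1 hv hw with h | h
  · exact key v w (lt_of_le_of_ne h hne) hv2 hw1
  · exact key w v (lt_of_le_of_ne h hne.symm) hw2 hv1

/-- The intervals tile `(0, h(u) ^ p]`. Comparing Lebesgue measures then performs the telescoping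
without enumerating a possibly infinite branch. -/
theorem iUnion_incrementSet {p : ℝ} (hp : 0 < p) {x : X} {u : BallVertex X}
    (hx : x ∈ (u : Set X)) : ⋃ v, incrementSet p x u v = Set.Ioc 0 (u.height ^ p) := by
  ext t
  simp only [Set.mem_iUnion]
  constructor
  · rintro ⟨v, hxv, hvu, h1, h2⟩
    refine ⟨(Real.rpow_nonneg v.1.height_nonneg p).trans_lt h1, h2.trans ?_⟩
    exact Real.rpow_le_rpow v.parent.height_nonneg (BallVertex.height_mono (v.parent_le hvu)) hp.le
  · rintro ⟨h0, h1⟩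
    set s : ℝ := t ^ p⁻¹ with hs
    have hs0 : 0 < s := Real.rpow_pos_of_pos h0 _
    have hst : s ^ p = t := by
      rw [hs, ← Real.rpow_mul h0.le, inv_mul_cancel₀ hp.ne', Real.rpow_one]
    -- This is the largest ball about `x` of height below `s`: any ball containing `x` of diameter
    -- below `2 * s` lies in it, so its parent has height at least `s`.
    obtain ⟨v, hv⟩ := BallVertex.exists_eq_ball x (s := 2 * s) (by linarith)
    have hxv : x ∈ (v : Set X) := by
      rw [hv]
      exact Metric.mem_ball_self (by linarith)
    have hvh : v.height < s := by
      have := BallVertex.diam_lt_of_eq_ball hv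
      unfold BallVertex.height
      linarith
    have hsu : s ≤ u.height := by
      rw [← hst] at h1
      exact (Real.rpow_le_rpow_iff hs0.le u.height_nonneg hp).1 h1
    have hvu : v < u := by
      rcases u.le_total_of_mem v hx hxv with h | h
      · exact absurd (BallVertex.height_mono h) (by linarith)
      · exact lt_of_le_of_ne h (by rintro rfl; linarith)
    let w : NonRootVertex X := ⟨v, fun h => hvu.not_ge (by
      show (u : Set X) ⊆ v
      rw [h]
      exact Set.subset_univ _)⟩
    refine ⟨w, hxv, hvu, ?_, ?_⟩
    · rw [← hst]
      exact Real.rpow_lt_rpow v.height_nonneg hvh hp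
    · rw [← hst]
      refine Real.rpow_le_rpow hs0.le ?_ hp.le
      by_contra! hlt
      refine w.lt_parent.not_ge ?_
      show (w.parent : Set X) ⊆ v
      intro y hy
      rw [hv]
      have := w.parent.dist_le_diam hy (w.lt_parent.le hxv)
      unfold BallVertex.height at hlt
      show dist y x < 2 * s
      linarith

open Classical in
/-- The increments of `h ^ p` between a vertex `u` and a point of `u` add up to `h(u) ^ p`. -/
theorem tsum_deltaHeight_lt {p : ℝ} (hp : 0 < p) {x : X} {u : BallVertex X}
    (hx : x ∈ (u : Set X)) :
    ∑' v : NonRootVertex X,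
      (if x ∈ (v.1 : Set X) ∧ v.1 < u then ENNReal.ofReal (v.deltaHeight p) else 0)
        = ENNReal.ofReal (u.height ^ p) := by
  have hv : ∀ v : NonRootVertex X, incrementSet p x u v =
      if x ∈ (v.1 : Set X) ∧ v.1 < u then Set.Ioc (v.1.height ^ p) (v.parent.height ^ p)
        else ∅ := by
    intro v
    ext t
    split_ifs with h
    · simp [incrementSet, h]
    · simp only [incrementSet, Set.mem_ofPred_eq, Set.mem_empty_iff_false, iff_false]
      exact fun h' => h ⟨h'.1, h'.2.1⟩
  have hm : ∀ v : NonRootVertex X, MeasurableSet (incrementSet p x u v) := by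
    intro v
    rw [hv]
    split_ifs
    · exact measurableSet_Ioc
    · exact MeasurableSet.empty
  have := measure_iUnion (μ := volume) (pairwise_disjoint_incrementSet hp x u) hm
  rw [iUnion_incrementSet hp hx, Real.volume_Ioc, sub_zero] at this
  rw [this]
  refine tsum_congr fun v => ?_
  rw [hv]
  split_ifs
  · rw [Real.volume_Ioc, deltaHeight]
  · simp

-- With `u` the least ball containing two distinct points `x` and `y`, a ball around `x` misses `y`
-- exactly when it lies strictly below `u`.
open Classical in
theorem tsum_deltaHeight_separating_left {p : ℝ} (hp : 0 < p) (x y : X) :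
    ∑' v : NonRootVertex X,
      (if x ∈ (v.1 : Set X) ∧ y ∉ (v.1 : Set X) then ENNReal.ofReal (v.deltaHeight p) else 0)
        = ENNReal.ofReal ((dist x y / 2) ^ p) := by
  rcases eq_or_ne x y with rfl | hxy
  · simp [Real.zero_rpow hp.ne']
  let u := BallVertex.ofBall x (dist x y) (dist_pos.2 hxy)
  have hxu : x ∈ (u : Set X) := Metric.mem_closedBall_self dist_nonneg
  have hyu : y ∈ (u : Set X) := by
    show dist y x ≤ dist x y
    rw [dist_comm]
  have hu : u.height = dist x y / 2 := by
    have hd : Metric.diam (u : Set X) = dist x y :=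
      le_antisymm (BallVertex.diam_closedBall_le x dist_nonneg) (u.dist_le_diam hxu hyu)
    rw [BallVertex.height, hd]
  rw [← hu, ← tsum_deltaHeight_lt hp hxu]
  refine tsum_congr fun v => ?_
  congr 1
  refine propext (and_congr_right fun hxv => ⟨fun hy => ?_, fun hvu hy => hvu.not_ge ?_⟩)
  · rcases u.le_total_of_mem v.1 hxu hxv with h | h
    · exact absurd (h hyu) hy
    · exact lt_of_le_of_ne h fun h => hy (h ▸ hyu)
  · obtain ⟨r, -, hr⟩ := v.1.exists_eq_closedBall hxv
    show Metric.closedBall x (dist x y) ⊆ v.1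
    rw [hr] at hy ⊢
    exact Metric.closedBall_subset_closedBall (by rw [dist_comm]; exact hy)

end NonRootVertex
/-! ### The transport cost as a sum over the tree -/

theorem ofReal_abs_measureReal_sub {X : Type*} [MeasurableSpace X] (μ ν : Measure X)
    [IsFiniteMeasure μ] [IsFiniteMeasure ν] (s : Set X) : ENNReal.ofReal |μ.real s - ν.real s| = (μ s - ν s) + (ν s - μ s) := by
  rcases le_total (μ.real s) (ν.real s) with h | h
  · have h' : μ s ≤ ν s := (ENNReal.toReal_le_toReal (by simp) (by simp)).1 h
    rw [abs_sub_comm, abs_of_nonneg (sub_nonneg.2 h), ENNReal.ofReal_sub _ measureReal_nonneg,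
      tsub_eq_zero_of_le h', zero_add]
    simp
  · have h' : ν s ≤ μ s := (ENNReal.toReal_le_toReal (by simp) (by simp)).1 h
    rw [abs_of_nonneg (sub_nonneg.2 h), ENNReal.ofReal_sub _ measureReal_nonneg,
      tsub_eq_zero_of_le h', add_zero]
    simp

theorem mixMeasure_real {X : Type*} [MeasurableSpace X] (t : ℝ) (ht : t ∈ Set.Icc (0 : ℝ) 1)
    (μ ν : ProbabilityMeasure X) (s : Set X) :
    (mixMeasure t ht μ ν : Measure X).real s =
      t * (μ : Measure X).real s + (1 - t) * (ν : Measure X).real s := by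
  have h1 : (0 : ℝ) ≤ 1 - t := sub_nonneg.2 ht.2
  show (ENNReal.ofReal t • (μ : Measure X) + ENNReal.ofReal (1 - t) • (ν : Measure X)).real s = _
  rw [measureReal_add_apply (ENNReal.mul_ne_top ENNReal.ofReal_ne_top (measure_ne_top _ _))
    (ENNReal.mul_ne_top ENNReal.ofReal_ne_top (measure_ne_top _ _))]
  simp [ht.1, h1]

theorem BallVertex.measurableSet {X : Type*} [MetricSpace X] [IsUltrametricDist X]
    [MeasurableSpace X] [BorelSpace X] (v : BallVertex X) : MeasurableSet (v : Set X) :=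
  v.isClopen.isClosed.measurableSet

theorem measurable_dist_rpow {X : Type*} [MetricSpace X] [CompactSpace X] [MeasurableSpace X]
    [BorelSpace X] (p : ℝ) :
    Measurable fun z : X × X => ENNReal.ofReal ((dist z.1 z.2 / 2) ^ p) := by
  have : SecondCountableTopology X := UniformSpace.secondCountable_of_separable X
  have : Measurable fun z : X × X => dist z.1 z.2 := continuous_dist.measurable
  fun_prop

/-- Serves to combine the sharp crossing bound on finitely many balls with a crude summable bound on
the others. -/
theorem ENNReal.tsum_le_tsum_add_tsum_compl {ι : Type*} {f g k : ι → ENNReal} (F : Finset ι)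
    (hg : ∀ i ∈ F, f i ≤ g i) (hk : ∀ i, f i ≤ k i) :
    ∑' i, f i ≤ ∑' i, g i + ∑' i : {i // i ∉ F}, k i := by
  have h : ∑' i : {i // i ∉ F}, k i = ∑' i, {i | i ∉ F}.indicator k i := tsum_subtype _ _
  rw [h, ← ENNReal.tsum_add]
  refine ENNReal.tsum_le_tsum fun i => ?_
  by_cases hi : i ∈ F
  · exact (hg i hi).trans le_self_add
  · rw [Set.indicator_of_mem (show i ∈ {i | i ∉ F} from hi)]
    exact (hk i).trans le_add_self

section Cost

variable {X : Type*} [MetricSpace X] [CompactSpace X] [IsUltrametricDist X]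
  [MeasurableSpace X] [BorelSpace X]

open Classical in
/-- The mass of the vertices, weighted by the increments of `h ^ p`, is finite. -/
theorem tsum_deltaHeight_mul_measure_ne_top {p : ℝ} (hp : 0 < p) (μ : Measure X)
    [IsFiniteMeasure μ] :
    ∑' v : NonRootVertex X, ENNReal.ofReal (v.deltaHeight p) * μ v.1 ≠ ⊤ := by
  cases isEmpty_or_nonempty X with
  | inl h =>
    have : IsEmpty (NonRootVertex X) := ⟨fun v => isEmptyElim v.1.nonempty.some⟩
    simp
  | inr h =>
    -- Taking `u` to be the root, the increments over all balls containing `x` add up to `h(o) ^ p`,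
    -- so the weighted mass is `h(o) ^ p * μ(X)`.
    have hlt : ∀ v : NonRootVertex X, v.1 < BallVertex.root X := fun v =>
      lt_of_le_of_ne (by
        show (v.1 : Set X) ⊆ BallVertex.root X
        rw [BallVertex.coe_root]
        exact Set.subset_univ _) fun h => v.2 (by rw [h, BallVertex.coe_root])
    have : ∑' v : NonRootVertex X, ENNReal.ofReal (v.deltaHeight p) * μ v.1 =
        ∫⁻ _, ENNReal.ofReal ((BallVertex.root X).height ^ p) ∂μ := by
      calc _ = ∑' v : NonRootVertex X, ∫⁻ x, (v.1 : Set X).indicator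
            (fun _ => ENNReal.ofReal (v.deltaHeight p)) x ∂μ := by
            refine tsum_congr fun v => ?_
            rw [lintegral_indicator_const v.1.measurableSet]
        _ = ∫⁻ x, ∑' v : NonRootVertex X, (v.1 : Set X).indicator
            (fun _ => ENNReal.ofReal (v.deltaHeight p)) x ∂μ :=
            (lintegral_tsum fun v =>
              (measurable_const.indicator v.1.measurableSet).aemeasurable).symm
        _ = _ := by
            refine lintegral_congr fun x => ?_
            rw [← NonRootVertex.tsum_deltaHeight_lt hp (x := x)
              (by rw [BallVertex.coe_root]; trivial)]
            refine tsum_congr fun v => ?_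
            simp [Set.indicator_apply, hlt v]
    rw [this, lintegral_const]
    exact ENNReal.mul_ne_top ENNReal.ofReal_ne_top (measure_ne_top _ _)

open Classical in
theorem lintegral_half_dist_rpow {p : ℝ} (hp : 0 < p) (P : Measure (X × X)) :
    ∫⁻ z, ENNReal.ofReal ((dist z.1 z.2 / 2) ^ p) ∂P =
      ∑' v : NonRootVertex X, ENNReal.ofReal (v.deltaHeight p) *
        P ((v.1 : Set X) ×ˢ (v.1 : Set X)ᶜ) := by
  have hm : ∀ v : NonRootVertex X, MeasurableSet ((v.1 : Set X) ×ˢ (v.1 : Set X)ᶜ) := fun v =>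
    v.1.measurableSet.prod v.1.measurableSet.compl
  calc _ = ∫⁻ z, ∑' v : NonRootVertex X, ((v.1 : Set X) ×ˢ (v.1 : Set X)ᶜ).indicator
          (fun _ => ENNReal.ofReal (v.deltaHeight p)) z ∂P := by
        refine lintegral_congr fun z => ?_
        rw [← NonRootVertex.tsum_deltaHeight_separating_left hp]
        refine tsum_congr fun v => ?_
        simp [Set.indicator_apply]
    _ = ∑' v : NonRootVertex X, ∫⁻ z, ((v.1 : Set X) ×ˢ (v.1 : Set X)ᶜ).indicator
          (fun _ => ENNReal.ofReal (v.deltaHeight p)) z ∂P :=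
        lintegral_tsum fun v => (measurable_const.indicator (hm v)).aemeasurable
    _ = _ := tsum_congr fun v => by rw [lintegral_indicator_const (hm v)]

/-- The transport cost of a measure on `X × X` in terms of the masses that it carries out of and
into the vertices of the tree. -/
theorem lintegral_dist_rpow {p : ℝ} (hp : 0 < p) (P : Measure (X × X)) :
    ∫⁻ z, ENNReal.ofReal (dist z.1 z.2 ^ p) ∂P =
      ENNReal.ofReal (2 ^ (p - 1)) * ∑' v : NonRootVertex X, ENNReal.ofReal (v.deltaHeight p) *
        (P ((v.1 : Set X) ×ˢ (v.1 : Set X)ᶜ) + P ((v.1 : Set X)ᶜ ×ˢ (v.1 : Set X))) := by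
  have hswap : ∫⁻ z, ENNReal.ofReal ((dist z.1 z.2 / 2) ^ p) ∂P =
      ∑' v : NonRootVertex X, ENNReal.ofReal (v.deltaHeight p) *
        P ((v.1 : Set X)ᶜ ×ˢ (v.1 : Set X)) := by
    have h := lintegral_half_dist_rpow hp (P.map Prod.swap)
    rw [lintegral_map (measurable_dist_rpow p) measurable_swap] at h
    simp only [Prod.fst_swap, Prod.snd_swap] at h
    simp only [dist_comm] at h ⊢
    rw [h]
    refine tsum_congr fun v => ?_
    rw [Measure.map_apply measurable_swap (v.1.measurableSet.prod v.1.measurableSet.compl),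
      Set.preimage_swap_prod]
  simp only [mul_add]
  rw [ENNReal.tsum_add, ← hswap, ← lintegral_half_dist_rpow hp, mul_add,
    ← lintegral_const_mul _ (measurable_dist_rpow p),
    ← lintegral_add_left ((measurable_dist_rpow p).const_mul _)]
  -- The two directions contribute `2 * (d / 2) ^ p`, and `2 ^ (p - 1)` is the factor that turns
  -- this into `d ^ p`.
  refine lintegral_congr fun z => ?_
  rw [← ENNReal.ofReal_mul (by positivity), ← ENNReal.ofReal_add (by positivity) (by positivity),
    Real.div_rpow dist_nonneg zero_le_two, Real.rpow_sub_one two_ne_zero]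
  congr 1
  have : (2 : ℝ) ^ p ≠ 0 := (Real.rpow_pos_of_pos two_pos p).ne'
  field_simp
  ring

/-- The sum over the tree of the weighted differences of two measures. -/
noncomputable def treeDist (p : ℝ) (μ ν : Measure X) : ENNReal :=
  ∑' v : NonRootVertex X, ENNReal.ofReal (v.deltaHeight p) * ((μ v.1 - ν v.1) + (ν v.1 - μ v.1))

theorem treeDist_ne_top {p : ℝ} (hp : 0 < p) (μ ν : Measure X) [IsFiniteMeasure μ]
    [IsFiniteMeasure ν] : treeDist p μ ν ≠ ⊤ := by
  refine ne_top_of_le_ne_top (tsum_deltaHeight_mul_measure_ne_top hp (μ + ν)) ?_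
  unfold treeDist
  gcongr with v
  rw [Measure.add_apply]
  exact add_le_add tsub_le_self tsub_le_self

theorem treeDist_eq_tsum_ofReal {p : ℝ} (hp : 0 < p) (μ ν : Measure X) [IsFiniteMeasure μ]
    [IsFiniteMeasure ν] : treeDist p μ ν =
      ∑' v : NonRootVertex X, ENNReal.ofReal (v.deltaHeight p * |μ.real v.1 - ν.real v.1|) := by
  refine tsum_congr fun v => ?_
  rw [ENNReal.ofReal_mul (v.deltaHeight_pos hp).le, ofReal_abs_measureReal_sub]

theorem summable_deltaHeight_mul {p : ℝ} (hp : 0 < p) (μ ν : Measure X) [IsFiniteMeasure μ]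
    [IsFiniteMeasure ν] :
    Summable fun v : NonRootVertex X => v.deltaHeight p * |μ.real v.1 - ν.real v.1| := by
  have h := treeDist_ne_top hp μ ν
  rw [treeDist_eq_tsum_ofReal hp] at h
  refine (ENNReal.summable_toReal h).congr fun v => ?_
  rw [ENNReal.toReal_ofReal (mul_nonneg (v.deltaHeight_pos hp).le (abs_nonneg _))]

theorem toReal_treeDist {p : ℝ} (hp : 0 < p) (μ ν : Measure X) [IsFiniteMeasure μ]
    [IsFiniteMeasure ν] : (treeDist p μ ν).toReal =
      ∑' v : NonRootVertex X, v.deltaHeight p * |μ.real v.1 - ν.real v.1| := by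
  have h0 : ∀ v : NonRootVertex X, 0 ≤ v.deltaHeight p * |μ.real v.1 - ν.real v.1| := fun v =>
    mul_nonneg (v.deltaHeight_pos hp).le (abs_nonneg _)
  rw [treeDist_eq_tsum_ofReal hp, ← ENNReal.ofReal_tsum_of_nonneg h0
    (summable_deltaHeight_mul hp μ ν), ENNReal.toReal_ofReal (tsum_nonneg h0)]

/-- Mass starting in a ball either ends there, where it counts towards `ν`, or leaves; so at least
the excess leaves. Symmetrically, at least the deficit enters. -/
theorem treeDist_le_lintegral {p : ℝ} (hp : 0 < p) {μ ν : ProbabilityMeasure X}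
    {P : Measure (X × X)} (hP : P ∈ transportPlans μ ν) :
    ENNReal.ofReal (2 ^ (p - 1)) * treeDist p (μ : Measure X) ν ≤
      ∫⁻ z, ENNReal.ofReal (dist z.1 z.2 ^ p) ∂P := by
  rw [lintegral_dist_rpow hp, treeDist]
  gcongr with v v
  · rw [← hP.1, ← hP.2, Measure.fst_apply v.1.measurableSet, Measure.snd_apply v.1.measurableSet,
      tsub_le_iff_left]
    refine (measure_mono fun z hz => ?_).trans (measure_union_le _ _)
    by_cases h : z.2 ∈ (v.1 : Set X)
    · exact Or.inl h
    · exact Or.inr ⟨hz, h⟩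
  · rw [← hP.1, ← hP.2, Measure.fst_apply v.1.measurableSet, Measure.snd_apply v.1.measurableSet,
      tsub_le_iff_left]
    refine (measure_mono fun z hz => ?_).trans (measure_union_le _ _)
    by_cases h : z.1 ∈ (v.1 : Set X)
    · exact Or.inl h
    · exact Or.inr ⟨h, hz⟩

/-- The greedy plan for `F` is sharp on the balls of `F`; on any other ball the mass leaving or
entering is bounded by the marginals. -/
theorem exists_transportPlan_lintegral_le {p : ℝ} (hp : 0 < p) (μ ν : ProbabilityMeasure X)
    (F : Finset (NonRootVertex X)) :
    ∃ P ∈ transportPlans μ ν, ∫⁻ z, ENNReal.ofReal (dist z.1 z.2 ^ p) ∂P ≤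
      ENNReal.ofReal (2 ^ (p - 1)) * (treeDist p (μ : Measure X) ν +
        ∑' v : {v // v ∉ F}, ENNReal.ofReal (v.1.deltaHeight p) *
          ((μ : Measure X) + (ν : Measure X)) v.1.1) := by
  classical
  obtain ⟨P, hP, hF⟩ := exists_transportPlan_of_laminar μ ν
    (F.image fun v => (v.1 : Set X)) (by
      intro C hC
      obtain ⟨v, -, rfl⟩ := Finset.mem_image.1 hC
      exact v.1.measurableSet) (by
      intro C hC D hD
      obtain ⟨v, -, rfl⟩ := Finset.mem_image.1 hC
      obtain ⟨w, -, rfl⟩ := Finset.mem_image.1 hD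
      exact v.1.subset_trichotomy w.1)
  refine ⟨P, hP, ?_⟩
  rw [lintegral_dist_rpow hp, treeDist]
  refine mul_le_mul_right (ENNReal.tsum_le_tsum_add_tsum_compl (k := fun v : NonRootVertex X =>
    ENNReal.ofReal (v.deltaHeight p) * ((μ : Measure X) + (ν : Measure X)) v.1) F
    (fun v hv => ?_) fun v => ?_) _
  · obtain ⟨h1, h2⟩ := hF v.1 (Finset.mem_image_of_mem (fun v => (v.1 : Set X)) hv)
    exact mul_le_mul_right (add_le_add h1 h2) _
  · refine mul_le_mul_right ?_ _
    rw [← hP.1, ← hP.2, Measure.add_apply, Measure.fst_apply v.1.measurableSet,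
      Measure.snd_apply v.1.measurableSet]
    exact add_le_add (measure_mono fun z hz => hz.1) (measure_mono fun z hz => hz.2)

/-! ### The infimum over transport plans -/

/-- The formula for the Wasserstein distance. -/
theorem wassersteinDist_rpow {p : ℝ} (hp : 0 < p) (μ ν : ProbabilityMeasure X) :
    wassersteinDist p μ ν ^ p = 2 ^ (p - 1) * ∑' v : NonRootVertex X,
        v.deltaHeight p * |(μ : Measure X).real v.1 - (ν : Measure X).real v.1| := by
  have hdist : Measurable fun z : X × X => dist z.1 z.2 := by
    have : SecondCountableTopology X := UniformSpace.secondCountable_of_separable X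
    exact continuous_dist.measurable
  have hint : ∀ P : Measure (X × X), ∫ z, dist z.1 z.2 ^ p ∂P =
      (∫⁻ z, ENNReal.ofReal (dist z.1 z.2 ^ p) ∂P).toReal := fun P =>
    integral_eq_lintegral_of_nonneg_ae (Filter.Eventually.of_forall fun z => by positivity)
      (hdist.pow_const p).aestronglyMeasurable
  set c := ENNReal.ofReal (2 ^ (p - 1)) with hc
  have hcT : c ≠ ⊤ := ENNReal.ofReal_ne_top
  set T := treeDist p (μ : Measure X) ν
  have hT : T ≠ ⊤ := treeDist_ne_top hp _ _
  set tail : Finset (NonRootVertex X) → ENNReal := fun F =>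
    ∑' v : {v // v ∉ F}, ENNReal.ofReal (v.1.deltaHeight p) *
      ((μ : Measure X) + (ν : Measure X)) v.1.1
  have hsum := tsum_deltaHeight_mul_measure_ne_top hp ((μ : Measure X) + (ν : Measure X))
  have htail : Filter.Tendsto tail Filter.atTop (nhds 0) :=
    ENNReal.tendsto_tsum_compl_atTop_zero hsum
  have htailT : ∀ F, tail F ≠ ⊤ := fun F =>
    ne_top_of_le_ne_top hsum (ENNReal.tsum_comp_le_tsum_of_injective Subtype.val_injective _)
  have hfin : ∀ P ∈ transportPlans μ ν, ∫⁻ z, ENNReal.ofReal (dist z.1 z.2 ^ p) ∂P ≠ ⊤ := by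
    intro P hP
    have : P Set.univ = 1 := by
      have h := Measure.fst_univ (ρ := P)
      rw [hP.1, measure_univ] at h
      exact h.symm
    refine ne_top_of_le_ne_top (b := ENNReal.ofReal (Metric.diam (Set.univ : Set X) ^ p)) ?_ ?_
    · exact ENNReal.ofReal_ne_top
    · calc _ ≤ ∫⁻ _, ENNReal.ofReal (Metric.diam (Set.univ : Set X) ^ p) ∂P := by
            gcongr with z
            exact Metric.dist_le_diam_of_mem Metric.isBounded_of_compactSpace trivial trivial
        _ = _ := by rw [lintegral_const, this, mul_one]
  have hinf : sInf ((fun P : Measure (X × X) => ∫ z, dist z.1 z.2 ^ p ∂P) '' transportPlans μ ν)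
      = (c * T).toReal := by
    have hlow : ∀ y ∈ (fun P : Measure (X × X) => ∫ z, dist z.1 z.2 ^ p ∂P) ''
        transportPlans μ ν, (c * T).toReal ≤ y := by
      rintro _ ⟨P, hP, rfl⟩
      show _ ≤ ∫ z, dist z.1 z.2 ^ p ∂P
      rw [hint]
      exact ENNReal.toReal_mono (hfin P hP) (treeDist_le_lintegral hp hP)
    refine le_antisymm ?_ (le_csInf ?_ hlow)
    -- The costs of the plans for `F` are squeezed to the lower bound as `F` exhausts the vertices.
    · have hlim : Filter.Tendsto (fun F => (c * (T + tail F)).toReal) Filter.atTop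
          (nhds (c * T).toReal) := by
        refine (ENNReal.tendsto_toReal (ENNReal.mul_ne_top hcT hT)).comp ?_
        refine ENNReal.Tendsto.const_mul ?_ (Or.inr hcT)
        simpa using htail.const_add T
      refine ge_of_tendsto' hlim fun F => ?_
      obtain ⟨P, hP, hle⟩ := exists_transportPlan_lintegral_le hp μ ν F
      refine (csInf_le ⟨_, hlow⟩ ⟨P, hP, rfl⟩).trans ?_
      show ∫ z, dist z.1 z.2 ^ p ∂P ≤ _
      rw [hint]
      exact ENNReal.toReal_mono (ENNReal.mul_ne_top hcT (ENNReal.add_ne_top.2 ⟨hT, htailT F⟩)) hle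
    · obtain ⟨P, hP, -⟩ := exists_transportPlan_lintegral_le hp μ ν ∅
      exact ⟨_, P, hP, rfl⟩
  rw [wassersteinDist, hinf, ← Real.rpow_mul ENNReal.toReal_nonneg, one_div,
    inv_mul_cancel₀ hp.ne', Real.rpow_one, ENNReal.toReal_mul, hc,
    ENNReal.toReal_ofReal (by positivity), toReal_treeDist hp]

/-! ### Separation of measures by balls and the embedding into `ℓ¹` -/

/-- A probability measure is determined by the masses of the vertices other than the root. -/
theorem ProbabilityMeasure.ext_of_nonRootVertex {μ ν : ProbabilityMeasure X}
    (h : ∀ v : NonRootVertex X, (μ : Measure X).real v.1 = (ν : Measure X).real v.1) : μ = ν := by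
  have hball : ∀ v : BallVertex X, (μ : Measure X) v = (ν : Measure X) v := by
    intro v
    by_cases hv : (v : Set X) = Set.univ
    · rw [hv, measure_univ, measure_univ]
    · exact (measureReal_eq_measureReal_iff (measure_ne_top _ _) (measure_ne_top _ _)).1
        (h ⟨v, hv⟩)
  have : SecondCountableTopology X := UniformSpace.secondCountable_of_separable X
  have hbasis : TopologicalSpace.IsTopologicalBasis
      (Set.range fun v : BallVertex X => (v : Set X)) := by
    refine TopologicalSpace.isTopologicalBasis_of_isOpen_of_nhds ?_ fun x U hx hU => ?_
    · rintro _ ⟨v, rfl⟩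
      exact v.isClopen.isOpen
    · obtain ⟨r, hr, hsub⟩ := Metric.nhds_basis_closedBall.mem_iff.1 (hU.mem_nhds hx)
      exact ⟨_, ⟨BallVertex.ofBall x r hr, rfl⟩, Metric.mem_closedBall_self hr.le, hsub⟩
  refine Subtype.ext (ext_of_generate_finite (μ := (μ : Measure X)) (ν := (ν : Measure X))
    (Set.range fun v : BallVertex X => (v : Set X))
    (by rw [BorelSpace.measurable_eq (α := X), hbasis.borel_eq_generateFrom]) ?_ ?_
    (by rw [measure_univ, measure_univ]))
  -- Two intersecting balls are nested, so their intersection is again a ball.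
  · rintro _ ⟨u, rfl⟩ _ ⟨v, rfl⟩ ⟨x, hxu, hxv⟩
    rcases u.le_total_of_mem v hxu hxv with h | h
    · exact ⟨u, (Set.inter_eq_left.2 h).symm⟩
    · exact ⟨v, (Set.inter_eq_right.2 h).symm⟩
  · rintro _ ⟨v, rfl⟩
    exact hball v

theorem summable_deltaHeight_mul_measureReal {p : ℝ} (hp : 0 < p) (μ : Measure X)
    [IsFiniteMeasure μ] :
    Summable fun v : NonRootVertex X => v.deltaHeight p * μ.real v.1 := by
  simpa [abs_of_nonneg] using summable_deltaHeight_mul hp μ 0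

/-- The weighted masses of the balls, as an element of `ℓ¹`. -/
noncomputable def treeEmbedding {p : ℝ} (hp : 0 < p) (e : NonRootVertex X ↪ ℕ)
    (μ : ProbabilityMeasure X) : lp (fun _ : ℕ => ℝ) 1 :=
  ⟨Function.extend e (fun v => 2 ^ (p - 1) * v.deltaHeight p * (μ : Measure X).real v.1) 0, by
    refine memℓp_gen ?_
    simp only [ENNReal.toReal_one, Real.rpow_one]
    refine Summable.norm ((summable_extend_zero e.injective).2 ?_)
    simpa only [mul_assoc] using
      (summable_deltaHeight_mul_measureReal hp (μ : Measure X)).mul_left (2 ^ (p - 1))⟩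

theorem treeEmbedding_apply {p : ℝ} (hp : 0 < p) (e : NonRootVertex X ↪ ℕ)
    (μ : ProbabilityMeasure X) (v : NonRootVertex X) :
    treeEmbedding hp e μ (e v) = 2 ^ (p - 1) * v.deltaHeight p * (μ : Measure X).real v.1 :=
  e.injective.extend_apply
    (fun v => 2 ^ (p - 1) * v.deltaHeight p * (μ : Measure X).real v.1) 0 v

theorem treeEmbedding_apply_of_notMem {p : ℝ} (hp : 0 < p) (e : NonRootVertex X ↪ ℕ)
    (μ : ProbabilityMeasure X) {n : ℕ} (hn : n ∉ Set.range e) : treeEmbedding hp e μ n = 0 :=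
  Function.extend_apply' (fun v : NonRootVertex X => 2 ^ (p - 1) * v.deltaHeight p * (μ : Measure X).real v.1)
    (0 : ℕ → ℝ) n hn

theorem norm_treeEmbedding_sub {p : ℝ} (hp : 0 < p) (e : NonRootVertex X ↪ ℕ)
    (μ ν : ProbabilityMeasure X) :
    ‖treeEmbedding hp e μ - treeEmbedding hp e ν‖ = wassersteinDist p μ ν ^ p := by
  rw [lp.norm_eq_tsum_rpow (by simp), wassersteinDist_rpow hp, ← tsum_mul_left]
  simp only [ENNReal.toReal_one, Real.rpow_one, div_one]
  -- The norm is a sum over `ℕ`; coordinates outside the range of `e` vanish, so it can be reindexed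
  -- by vertices.
  rw [← e.injective.tsum_eq]
  · refine tsum_congr fun v => ?_
    rw [lp.coeFn_sub, Pi.sub_apply, treeEmbedding_apply, treeEmbedding_apply, ← mul_sub, norm_mul,
      norm_mul, Real.norm_of_nonneg (by positivity), Real.norm_of_nonneg (v.deltaHeight_pos hp).le,
      Real.norm_eq_abs, mul_assoc]
  · intro n hn
    by_contra h
    refine hn ?_
    show ‖(treeEmbedding hp e μ - treeEmbedding hp e ν) n‖ = 0
    rw [lp.coeFn_sub, Pi.sub_apply, treeEmbedding_apply_of_notMem hp e μ h,
      treeEmbedding_apply_of_notMem hp e ν h, sub_zero, norm_zero]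

theorem treeEmbedding_mixMeasure {p : ℝ} (hp : 0 < p) (e : NonRootVertex X ↪ ℕ)
    (μ ν : ProbabilityMeasure X) (t : ℝ) (ht : t ∈ Set.Icc (0 : ℝ) 1) :
    treeEmbedding hp e (mixMeasure t ht μ ν) =
      t • treeEmbedding hp e μ + (1 - t) • treeEmbedding hp e ν := by
  refine lp.ext (funext fun n => ?_)
  rw [lp.coeFn_add, lp.coeFn_smul, lp.coeFn_smul, Pi.add_apply, Pi.smul_apply, Pi.smul_apply]
  by_cases hn : n ∈ Set.range e
  · obtain ⟨v, rfl⟩ := hn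
    simp only [treeEmbedding_apply, mixMeasure_real, smul_eq_mul]
    ring
  · simp [treeEmbedding_apply_of_notMem hp e _ hn]

theorem treeEmbedding_injective {p : ℝ} (hp : 0 < p) (e : NonRootVertex X ↪ ℕ) :
    Function.Injective (treeEmbedding (X := X) hp e) := by
  intro μ ν h
  refine ProbabilityMeasure.ext_of_nonRootVertex fun v => ?_
  have hv : treeEmbedding hp e μ (e v) = treeEmbedding hp e ν (e v) := by rw [h]
  rw [treeEmbedding_apply, treeEmbedding_apply] at hv
  exact mul_left_cancel₀
    (mul_pos (Real.rpow_pos_of_pos two_pos _) (v.deltaHeight_pos hp)).ne' hv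

theorem convex_range_treeEmbedding {p : ℝ} (hp : 0 < p) (e : NonRootVertex X ↪ ℕ) :
    Convex ℝ (Set.range (treeEmbedding (X := X) hp e)) := by
  rintro _ ⟨μ, rfl⟩ _ ⟨ν, rfl⟩ a b ha hb hab
  have hb' : b = 1 - a := by linarith
  subst hb'
  exact ⟨mixMeasure a ⟨ha, by linarith⟩ μ ν, treeEmbedding_mixMeasure hp e μ ν a _⟩

end Cost

theorem mainTheorem1 {X : Type*} [MetricSpace X] [CompactSpace X] [IsUltrametricDist X]
    [MeasurableSpace X] [BorelSpace X] (p : ℝ) (hp : 1 ≤ p) :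
    -- the formula for the Wasserstein distance
    (∀ μ ν : ProbabilityMeasure X,
      Summable (fun v : NonRootVertex X =>
        v.deltaHeight p * |(μ : Measure X).real v.1 - (ν : Measure X).real v.1|) ∧
      wassersteinDist p μ ν ^ p = 2 ^ (p - 1) * ∑' v : NonRootVertex X,
        v.deltaHeight p * |(μ : Measure X).real v.1 - (ν : Measure X).real v.1|) ∧
    -- the vertices other than the root can be enumerated
    Nonempty (NonRootVertex X ↪ ℕ) ∧
    -- and, whatever the enumeration, the weighted masses of the balls are the coordinates of an
    -- affine isometry onto a convex subset of `ℓ¹`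
    ∀ e : NonRootVertex X ↪ ℕ, ∃ φ : ProbabilityMeasure X → lp (fun _ : ℕ => ℝ) 1,
      (∀ (μ : ProbabilityMeasure X) (v : NonRootVertex X),
        φ μ (e v) = 2 ^ (p - 1) * v.deltaHeight p * (μ : Measure X).real v.1) ∧
      (∀ (μ : ProbabilityMeasure X) (n : ℕ), n ∉ Set.range e → φ μ n = 0) ∧
      (∀ (μ ν : ProbabilityMeasure X) (t : ℝ) (ht : t ∈ Set.Icc (0 : ℝ) 1),
        φ (mixMeasure t ht μ ν) = t • φ μ + (1 - t) • φ ν) ∧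
      (∀ μ ν : ProbabilityMeasure X, ‖φ μ - φ ν‖ = wassersteinDist p μ ν ^ p) ∧
      Function.Injective φ ∧
      Convex ℝ (Set.range φ) := by
  have hp0 : 0 < p := zero_lt_one.trans_le hp
  refine ⟨fun μ ν => ⟨summable_deltaHeight_mul hp0 _ _, wassersteinDist_rpow hp0 μ ν⟩, ?_,
    fun e => ⟨treeEmbedding hp0 e, treeEmbedding_apply hp0 e,
      fun μ n hn => treeEmbedding_apply_of_notMem hp0 e μ hn, treeEmbedding_mixMeasure hp0 e,
      norm_treeEmbedding_sub hp0 e, treeEmbedding_injective hp0 e,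
      convex_range_treeEmbedding hp0 e⟩⟩
  exact Countable.exists_injective_nat (NonRootVertex X) |>.elim fun f hf => ⟨⟨f, hf⟩⟩
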